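/- Let $\alpha>0$, and let $F$ be a distribution function with $F(x)=0$ for $x<1$, with tail $\bar F=1-F$. For $s\in(0,1)$ let $F^{\leftarrow}(s)=\inf\{x>0: F(x)\ge s\}$. Assume that $\bar F\in\mathrm{RV}_{-\alpha}$, i.e. $\lim_{t\to\infty}\bar F(tx)/\bar F(t)=x^{-\alpha}$ for every $x>0$, that $\bar F$ is continuous, and that $F^{\leftarrow}$ is continuous on $(0,1)$. Write $\bar F(x)=x^{-\alpha}L(x)$. Call $F$ eventually Pareto if there are $x_0$ and $c>0$ with $\bar F(x)=c\,x^{-\alpha}$ for all $x\ge x_0$. For $x \geq 1$ put $$\mathcal U(x)=\frac{\alpha\int_0^{\bar F(x)}\log F^{\leftarrow}(1-s)\,ds-(\alpha\log x+1)\bar F(x)}{\int_0^{\bar F(x)}\log\frac{F^{\leftarrow}(1-s)}{x}\,ds},\qquad M(x)=\sup_{y\ge1}y^{-\alpha}\Big|y^{\mathcal U(x)}-\frac{L(xy)}{L(x)}\Big|.$$ Let $X_1,X_2,\dots$ be i.i.d. with distribution function $F$, and let $X_{1:n}\le\dots\le X_{n:n}$ be the order statistics of $X_1,\dots,X_n$.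 For $1\le k\le n-1$ let $$\widehat\alpha_{n,k}=\Big(\frac1k\sum_{i=1}^k\log\frac{X_{n-k+i:n}}{X_{n-k:n}}\Big)^{-1},\qquad D_{n,k}=\sup_{y\ge1}\Big|\frac1k\sum_{i=1}^k\mathbf 1_{(y,\infty)}\Big(\frac{X_{n-k+i:n}}{X_{n-k:n}}\Big)-y^{-\widehat\alpha_{n,k}}\Big|,$$ and let $\kappa_n^\star$ be the smallest minimizer of $k\mapsto D_{n,k}$ over $1\le k\le n-1$ ($n\ge2$). Write $[\cdot]$ for the integer part. Then: 1. For every $x\ge1$ the integrals in $\mathcal U(x)$ are finite, the denominator is strictly positive, and $M(x)<\infty$. 2. For every $x$ with $F(x)>0$, $D_{n,[\bar F(x)n]}\to M(x)$ in probability as $n\to\infty$. 3. If $F$ is not eventually Pareto, then $M(x)>0$ for every $x\ge1$. 4. If $F$ is not eventually Pareto, then $\kappa_n^\star/n\to0$ in probability as $n\to\infty$. -/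

import Mathlib

open MeasureTheory ProbabilityTheory Filter Topology Set

noncomputable section

/-- `f` is regularly varying at infinity with index `ρ`. -/
def RegularlyVarying (ρ : ℝ) (f : ℝ → ℝ) : Prop :=
  ∀ x : ℝ, 0 < x → Tendsto (fun t : ℝ => f (t * x) / f t) atTop (𝓝 (x ^ ρ))

/-- The tail `1 - F` of a distribution function. -/
def tailFn (F : ℝ → ℝ) (x : ℝ) : ℝ := 1 - F x

/-- The generalized inverse of `F`, used for levels `s ∈ (0,1)`. -/
def genInv (F : ℝ → ℝ) (s : ℝ) : ℝ := sInf {x : ℝ | 0 < x ∧ s ≤ F x}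

/-- The factor `L` in `1 - F x = x ^ (-α) * L x`. -/
def slowPart (α : ℝ) (F : ℝ → ℝ) (x : ℝ) : ℝ := x ^ α * tailFn F x

/-- The tail is exactly `c * x ^ (-α)` from some point on. -/
def EventuallyPareto (α : ℝ) (F : ℝ → ℝ) : Prop :=
  ∃ x₀ c : ℝ, 0 < c ∧ ∀ x : ℝ, x₀ ≤ x → tailFn F x = c * x ^ (-α)

/-- The exponent `U(x)`. -/
def calU (α : ℝ) (F : ℝ → ℝ) (x : ℝ) : ℝ :=
  (α * (∫ s in (0 : ℝ)..tailFn F x, Real.log (genInv F (1 - s)))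
      - (α * Real.log x + 1) * tailFn F x) /
    ∫ s in (0 : ℝ)..tailFn F x, Real.log (genInv F (1 - s) / x)

/-- The function of `y` whose supremum over `y ≥ 1` is the limiting distance at `x`. -/
def limitGap (α : ℝ) (F : ℝ → ℝ) (x y : ℝ) : ℝ :=
  y ^ (-α) * |y ^ calU α F x - slowPart α F (x * y) / slowPart α F x|

/-- The `j`-th smallest of the numbers `x 0, …, x (n - 1)`, for `1 ≤ j ≤ n`
(and `0` for all other `j`, which is never used). -/
def orderStat (x : ℕ → ℝ) (n j : ℕ) : ℝ :=
  if h : 1 ≤ j ∧ j ≤ n then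
    x (Tuple.sort (fun i : Fin n => x i) ⟨j - 1, by omega⟩)
  else 0

/-- The average of the `k` largest log-excesses over `X_{n-k:n}`, for `1 ≤ k ≤ n - 1`. -/
def hillH (x : ℕ → ℝ) (n k : ℕ) : ℝ :=
  (1 / (k : ℝ)) *
    ∑ i ∈ Finset.Icc 1 k, Real.log (orderStat x n (n - k + i) / orderStat x n (n - k))

/-- Hill's estimator of the tail exponent. -/
def hillAlpha (x : ℕ → ℝ) (n k : ℕ) : ℝ := (hillH x n k)⁻¹

/-- The Kolmogorov-Smirnov distance `D_{n,k}` between the empirical tail of the `k` largest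
observations, rescaled by `X_{n-k:n}`, and the fitted Pareto tail, for `1 ≤ k ≤ n - 1`. -/
def ksDist (x : ℕ → ℝ) (n k : ℕ) : ℝ :=
  ⨆ y : Ici (1 : ℝ),
    |(1 / (k : ℝ)) * (∑ i ∈ Finset.Icc 1 k,
        (Ioi (y : ℝ)).indicator (fun _ => (1 : ℝ))
          (orderStat x n (n - k + i) / orderStat x n (n - k)))
      - (y : ℝ) ^ (-hillAlpha x n k)|

/-- The smallest minimizer of `k ↦ D_{n,k}` over `1 ≤ k ≤ n - 1` (meaningful for `n ≥ 2`). -/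
def plfitOpt (x : ℕ → ℝ) (n : ℕ) : ℕ :=
  sInf {k : ℕ | (1 ≤ k ∧ k < n) ∧ ∀ j : ℕ, 1 ≤ j → j < n → ksDist x n k ≤ ksDist x n j}

end

/-! The distance at `k` depends on the sample through the empirical tail and the empirical mean
log-excess, both taken at the random threshold `X_{n-k:n}`. They converge pointwise by the law of
large numbers. As they are monotone with continuous limits, the random threshold does no harm
(`tendsto_apply_of_antitone`) and the tails converge uniformly (`tendstoUniformlyOn_of_antitoneOn`).

With `m(x)` the conditional mean log-excess over `x`, one finds `U(x) = α - 1/m(x)`. So `M(x)` is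
the Kolmogorov-Smirnov distance between the law of `Z/x` given `Z > x` and the Pareto law with
exponent `1/m(x)` (`limitGap_eq`). If it vanishes, the tail is a pure power beyond `x`, with
exponent `-α` by regular variation. By Karamata's theorem, `M(x) → 0` at infinity.

If `κ*/n` had a limit point `u > 0`, the distance at `κ*` would approach `M(t) > 0`, where the tail
at `t` is `u`. Minimality gives `M(t) ≤ M(z)` for all large `z`, hence `M(t) ≤ 0`, a contradiction.
Limit points are taken along ultrafilters finer than `whp P`, in place of subsequences. -/

/-! ### Convergence with high probability as convergence along a filter -/

/-- The filter of sets of pairs `(ω, n)` that hold with probability tending to one. -/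
def whp {Ω : Type*} [MeasurableSpace Ω] (P : Measure Ω) : Filter (Ω × ℕ) where
  sets := {S | Tendsto (fun n => P {ω | (ω, n) ∉ S}) atTop (𝓝 0)}
  univ_sets := by simp
  sets_of_superset {S T} hS hST :=
    tendsto_of_tendsto_of_tendsto_of_le_of_le tendsto_const_nhds hS (fun _ => zero_le)
      (fun n => measure_mono fun ω h h' => h (hST h'))
  inter_sets {S T} hS hT := by
    have h := Tendsto.add hS hT
    rw [add_zero] at h
    refine tendsto_of_tendsto_of_tendsto_of_le_of_le tendsto_const_nhds h (fun _ => zero_le)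
      (fun n => (measure_mono ?_).trans (measure_union_le _ _))
    intro ω hω
    simp only [mem_inter_iff, mem_ofPred_eq, not_and_or, mem_union] at hω ⊢
    exact hω

section WithHighProbability

variable {Ω : Type*} [MeasurableSpace Ω] {P : Measure Ω}

lemma mem_whp {S : Set (Ω × ℕ)} :
    S ∈ whp P ↔ Tendsto (fun n => P {ω | (ω, n) ∉ S}) atTop (𝓝 0) := Iff.rfl

/-- Convergence in probability becomes an ordinary `Tendsto`, so limit algebra and ultrafilter
compactness apply to random quantities directly. -/
lemma tendstoInMeasure_const_iff_whp {f : ℕ → Ω → ℝ} {c : ℝ} :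
    TendstoInMeasure P f atTop (fun _ => c) ↔
      Tendsto (fun p : Ω × ℕ => f p.2 p.1) (whp P) (𝓝 c) := by
  rw [tendstoInMeasure_iff_dist, Metric.tendsto_nhds]
  refine forall₂_congr fun ε hε => ?_
  rw [Filter.Eventually, mem_whp]
  simp only [mem_ofPred_eq, not_lt]

lemma tendsto_snd_whp : Tendsto (fun p : Ω × ℕ => p.2) (whp P) atTop := by
  rw [tendsto_atTop]
  intro N
  rw [Filter.Eventually, mem_whp]
  refine tendsto_const_nhds.congr' ?_
  filter_upwards [eventually_ge_atTop N] with n hn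
  simp [hn]

lemma eventually_whp_of_ae {p : Ω → Prop} (h : ∀ᵐ ω ∂P, p ω) :
    ∀ᶠ q in whp P, p q.1 := by
  rw [Filter.Eventually, mem_whp]
  have : P {ω | ¬ p ω} = 0 := h
  simp [this]

end WithHighProbability

/-! ### Antitone functions converging to a continuous limit -/

section Antitone

variable {ι : Type*} {l : Filter ι} {f : ι → ℝ → ℝ} {g : ℝ → ℝ}

/-- The moving point `T i` is eventually on a known side of any fixed `z ≠ t`. Monotonicity then
compares `f i (T i)` with `f i z`, and `z` is chosen so that `g z` is near `g t`. No uniform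
convergence is needed. -/
lemma tendsto_apply_of_antitone {T : ι → ℝ} {t : ℝ} (hf : ∀ᶠ i in l, Antitone (f i))
    (hlim : ∀ z, Tendsto (fun i => f i z) l (𝓝 (g z))) (hg : ContinuousAt g t)
    (hT : Tendsto T l (𝓝 t)) : Tendsto (fun i => f i (T i)) l (𝓝 (g t)) := by
  rw [tendsto_order]
  constructor
  · intro a ha
    obtain ⟨z, hz, htz⟩ := (((hg.eventually (lt_mem_nhds ha)).filter_mono
      nhdsWithin_le_nhds).and (self_mem_nhdsWithin (a := t) (s := Ioi t))).exists
    filter_upwards [hf, (hlim z).eventually (lt_mem_nhds hz), hT.eventually (gt_mem_nhds htz)]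
      with i h1 h2 h3
    exact h2.trans_le (h1 h3.le)
  · intro a ha
    obtain ⟨z, hz, htz⟩ := (((hg.eventually (gt_mem_nhds ha)).filter_mono
      nhdsWithin_le_nhds).and (self_mem_nhdsWithin (a := t) (s := Iio t))).exists
    filter_upwards [hf, (hlim z).eventually (gt_mem_nhds hz), hT.eventually (lt_mem_nhds htz)]
      with i h1 h2 h3
    exact (h1 h3.le).trans_lt h2

lemma Ultrafilter.exists_tendsto_nhds_of_mem_Icc (U : Ultrafilter ι) {u : ι → ℝ} {a b : ℝ}
    (h : ∀ᶠ i in (U : Filter ι), u i ∈ Icc a b) :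
    ∃ t ∈ Icc a b, Tendsto u U (𝓝 t) := by
  obtain ⟨t, ht, hle⟩ := (isCompact_Icc (a := a) (b := b)).ultrafilter_le_nhds (U.map u)
    (le_principal_iff.2 h)
  exact ⟨t, ht, hle⟩

/-- Pólya's theorem: antitone functions on `[1, ∞)` converging pointwise to a continuous limit
which vanishes at infinity converge uniformly. -/
lemma tendstoUniformlyOn_of_antitoneOn
    (hf : ∀ᶠ i in l, AntitoneOn (f i) (Ici 1) ∧ ∀ y, 1 ≤ y → 0 ≤ f i y)
    (hg : ContinuousOn g (Ici 1)) (hg0 : Tendsto g atTop (𝓝 0))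
    (hlim : ∀ y, 1 ≤ y → Tendsto (fun i => f i y) l (𝓝 (g y))) :
    TendstoUniformlyOn f g l (Ici 1) := by
  have key : Tendsto (fun q : ι × ℝ => f q.1 q.2 - g q.2) (l ×ˢ 𝓟 (Ici 1)) (𝓝 0) := by
    rw [tendsto_iff_ultrafilter]
    intro U hU
    have hfst : Tendsto (fun q : ι × ℝ => q.1) U l := tendsto_fst.mono_left hU
    have hsnd : ∀ᶠ q : ι × ℝ in (U : Filter _), 1 ≤ q.2 := by
      have := (tendsto_snd (f := l) (g := 𝓟 (Ici (1 : ℝ)))).mono_left hU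
      exact tendsto_principal.1 this
    -- Along an ultrafilter the point either stays bounded, hence converges, or tends to infinity.
    -- In the second case `f` is squeezed between `0` and its value at a fixed large `B`.
    by_cases h : ∃ B : ℝ, ∀ᶠ q : ι × ℝ in (U : Filter _), q.2 ≤ B
    · obtain ⟨B, hB⟩ := h
      obtain ⟨t, ht, htU⟩ := U.exists_tendsto_nhds_of_mem_Icc (u := fun q : ι × ℝ => q.2)
        (a := 1) (b := B) (hsnd.and hB)
      -- Composing with `max 1` extends everything from `[1, ∞)` to the whole line.
      have hmax : ContinuousOn (fun y : ℝ => max 1 y) univ := by fun_prop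
      have hgc : Continuous fun y : ℝ => g (max 1 y) := by
        rw [← continuousOn_univ]
        exact hg.comp hmax fun y _ => mem_Ici.2 (le_max_left _ _)
      have h1 := tendsto_apply_of_antitone (l := (U : Filter (ι × ℝ)))
        (f := fun q y => f q.1 (max 1 y)) (g := fun y => g (max 1 y))
        (T := fun q => q.2) (t := t)
        ((hfst.eventually hf).mono fun q hq a b hab =>
          hq.1 (mem_Ici.2 (le_max_left _ _)) (mem_Ici.2 (le_max_left _ _)) (max_le_max le_rfl hab))
        (fun z => (hlim _ (le_max_left _ _)).comp hfst) hgc.continuousAt htU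
      have h2 := (hgc.tendsto t).comp htU
      have h3 := h1.sub h2
      rw [sub_self] at h3
      refine h3.congr' ?_
      filter_upwards [hsnd] with q hq
      simp [max_eq_right hq]
    · have htop : Tendsto (fun q : ι × ℝ => q.2) U atTop := by
        rw [tendsto_atTop]
        intro B
        have : ∀ᶠ q : ι × ℝ in (U : Filter _), ¬ q.2 ≤ B :=
          Ultrafilter.eventually_not.2 fun hB => h ⟨B, hB⟩
        filter_upwards [this] with q hq
        exact (not_le.1 hq).le
      have h2 : Tendsto (fun q : ι × ℝ => g q.2) U (𝓝 0) := hg0.comp htop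
      have h1 : Tendsto (fun q : ι × ℝ => f q.1 q.2) U (𝓝 0) := by
        rw [tendsto_order]
        constructor
        · intro a ha
          filter_upwards [hfst.eventually hf, hsnd] with q hq hq1
          exact ha.trans_le (hq.2 _ hq1)
        · intro a ha
          obtain ⟨B, hB, hB1⟩ := ((hg0.eventually (gt_mem_nhds ha)).and
            (eventually_ge_atTop 1)).exists
          filter_upwards [hfst.eventually hf, hsnd, htop.eventually (eventually_ge_atTop B),
            hfst.eventually ((hlim B hB1).eventually (gt_mem_nhds hB))] with q hq hq1 hq2 hq3
          exact (hq.1 hB1 hq1 hq2).trans_lt hq3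
      simpa using h1.sub h2
  rw [Metric.tendstoUniformlyOn_iff]
  intro ε hε
  rw [← eventually_prod_principal_iff (p := fun q : ι × ℝ => dist (g q.2) (f q.1 q.2) < ε)]
  filter_upwards [(Metric.tendsto_nhds.1 key) ε hε] with q hq
  rw [dist_comm, Real.dist_eq]
  simpa using hq

/-- The supremum is 1-Lipschitz for the uniform distance; boundedness of `f i` is inherited from `g`
once the two are close. -/
lemma tendsto_iSup_of_tendstoUniformlyOn {f : ι → ℝ → ℝ} {g : ℝ → ℝ}
    (h : TendstoUniformlyOn f g l (Ici 1))
    (hg : BddAbove (range fun y : Ici (1 : ℝ) => g y)) :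
    Tendsto (fun i => ⨆ y : Ici (1 : ℝ), f i y) l (𝓝 (⨆ y : Ici (1 : ℝ), g y)) := by
  rw [Metric.tendsto_nhds]
  intro ε hε
  filter_upwards [(Metric.tendstoUniformlyOn_iff.1 h) (ε / 2) (half_pos hε)] with i hi
  have hi' : ∀ y : Ici (1 : ℝ), |g y - f i y| < ε / 2 := fun y => by
    simpa [Real.dist_eq] using hi y y.2
  have : Nonempty (Ici (1 : ℝ)) := ⟨⟨1, mem_Ici.2 le_rfl⟩⟩
  have hle : ∀ y : Ici (1 : ℝ), f i y ≤ (⨆ y : Ici (1 : ℝ), g y) + ε / 2 := fun y => by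
    have := le_ciSup hg y
    have := abs_lt.1 (hi' y)
    linarith
  have hb : BddAbove (range fun y : Ici (1 : ℝ) => f i y) := ⟨_, by rintro _ ⟨y, rfl⟩; exact hle y⟩
  have h1 := ciSup_le hle
  have h2 : (⨆ y : Ici (1 : ℝ), g y) ≤ (⨆ y : Ici (1 : ℝ), f i y) + ε / 2 := ciSup_le fun y => by
    have := le_ciSup hb y
    have := abs_lt.1 (hi' y)
    linarith
  rw [Real.dist_eq, abs_lt]
  constructor <;> linarith

end Antitone

lemma antitoneOn_rpow_neg {a : ℝ} (ha : 0 ≤ a) :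
    AntitoneOn (fun y : ℝ => y ^ (-a)) (Ici 1) := fun _ hx _ _ hxy =>
  Real.rpow_le_rpow_of_nonpos (zero_lt_one.trans_le hx) hxy (neg_nonpos.2 ha)

lemma tendstoUniformlyOn_rpow_neg {ι : Type*} {l : Filter ι} {a : ι → ℝ} {b : ℝ}
    (ha : ∀ᶠ i in l, 0 ≤ a i) (hb : 0 < b) (h : Tendsto a l (𝓝 b)) :
    TendstoUniformlyOn (fun i (y : ℝ) => y ^ (-a i)) (fun y => y ^ (-b)) l (Ici 1) := by
  refine tendstoUniformlyOn_of_antitoneOn ?_ ?_ (tendsto_rpow_neg_atTop hb) ?_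
  · filter_upwards [ha] with i hi
    exact ⟨antitoneOn_rpow_neg hi, fun y hy => Real.rpow_nonneg (zero_le_one.trans hy) _⟩
  · exact continuousOn_id.rpow_const fun y hy => Or.inl (zero_lt_one.trans_le hy).ne'
  · intro y hy
    exact (Real.continuousAt_const_rpow (zero_lt_one.trans_le hy).ne').tendsto.comp h.neg

lemma tendsto_iSup_abs_sub {ι : Type*} {l : Filter ι} {f₁ f₂ : ι → ℝ → ℝ} {g₁ g₂ : ℝ → ℝ}
    (h₁ : TendstoUniformlyOn f₁ g₁ l (Ici 1)) (h₂ : TendstoUniformlyOn f₂ g₂ l (Ici 1))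
    (hg : BddAbove (range fun y : Ici (1 : ℝ) => |g₁ y - g₂ y|)) :
    Tendsto (fun i => ⨆ y : Ici (1 : ℝ), |f₁ i y - f₂ i y|) l
      (𝓝 (⨆ y : Ici (1 : ℝ), |g₁ y - g₂ y|)) := by
  refine tendsto_iSup_of_tendstoUniformlyOn (f := fun i y => |f₁ i y - f₂ i y|)
    (g := fun y => |g₁ y - g₂ y|) ?_ hg
  have := h₁.sub h₂
  rw [Metric.tendstoUniformlyOn_iff] at this ⊢
  intro ε hε
  filter_upwards [this ε hε] with i hi y hy
  refine lt_of_le_of_lt ?_ (hi y hy)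
  simp only [Real.dist_eq, Pi.sub_apply]
  exact abs_abs_sub_abs_le_abs_sub _ _

/-! ### Sums over order statistics -/

section OrderStat

variable {x : ℕ → ℝ} {n : ℕ}

lemma orderStat_mono {i j : ℕ} (hi : 1 ≤ i) (hij : i ≤ j) (hj : j ≤ n) :
    orderStat x n i ≤ orderStat x n j := by
  rw [orderStat, orderStat, dif_pos ⟨hi, hij.trans hj⟩, dif_pos ⟨hi.trans hij, hj⟩]
  exact Tuple.monotone_sort (fun i : Fin n => x i) (by simp only [Fin.mk_le_mk]; omega)

lemma sum_orderStat (φ : ℝ → ℝ) :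
    ∑ j ∈ Finset.Icc 1 n, φ (orderStat x n j) = ∑ i ∈ Finset.range n, φ (x i) := by
  have h1 : ∑ j ∈ Finset.Icc 1 n, φ (orderStat x n j)
      = ∑ i ∈ Finset.range n, φ (orderStat x n (i + 1)) := by
    rw [Finset.range_eq_Ico, Finset.sum_Ico_add' (fun j => φ (orderStat x n j)) 0 n 1]
    rfl
  rw [h1, Finset.sum_range, Finset.sum_range]
  rw [← Equiv.sum_comp (Tuple.sort (fun i : Fin n => x i)) (fun i : Fin n => φ (x i))]
  refine Finset.sum_congr rfl fun i _ => ?_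
  rw [orderStat, dif_pos ⟨by omega, by omega⟩]
  rfl

lemma exists_orderStat_eq {j : ℕ} (h1 : 1 ≤ j) (h2 : j ≤ n) : ∃ i, orderStat x n j = x i := by
  rw [orderStat, dif_pos ⟨h1, h2⟩]
  exact ⟨_, rfl⟩

/-- The order statistics left out lie at or below the threshold, where `φ` vanishes. This holds also
with ties, and turns sums over the top `k` into full sample sums, to which the law of large numbers
applies. -/
lemma sum_Icc_orderStat_top {k : ℕ} (hk : k < n) (φ : ℝ → ℝ)
    (hφ : ∀ z ≤ orderStat x n (n - k), φ z = 0) :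
    ∑ i ∈ Finset.Icc 1 k, φ (orderStat x n (n - k + i)) = ∑ i ∈ Finset.range n, φ (x i) := by
  rw [← sum_orderStat φ]
  have h : ∑ i ∈ Finset.Icc 1 k, φ (orderStat x n (n - k + i))
      = ∑ j ∈ Finset.Icc (n - k + 1) n, φ (orderStat x n j) := by
    refine Finset.sum_bij (fun i _ => n - k + i) ?_ ?_ ?_ ?_
    · intro i hi; rw [Finset.mem_Icc] at hi ⊢; omega
    · intro i _ j _ h; omega
    · intro j hj
      rw [Finset.mem_Icc] at hj
      exact ⟨j - (n - k), Finset.mem_Icc.2 (by omega), by omega⟩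
    · intro i _; rfl
  rw [h]
  refine Finset.sum_subset (Finset.Icc_subset_Icc (by omega) le_rfl) fun j hj hj' => ?_
  rw [Finset.mem_Icc] at hj hj'
  exact hφ _ (orderStat_mono hj.1 (by omega) (by omega))

end OrderStat

/-- The fraction of `x 0, …, x (n - 1)` exceeding `z`. -/
noncomputable def empTail (x : ℕ → ℝ) (n : ℕ) (z : ℝ) : ℝ :=
  (∑ i ∈ Finset.range n, (Ioi z).indicator (fun _ => (1 : ℝ)) (x i)) / n

/-- The average of the excesses of `log (x 0), …, log (x (n - 1))` over `v`. -/
noncomputable def empExcess (x : ℕ → ℝ) (n : ℕ) (v : ℝ) : ℝ :=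
  (∑ i ∈ Finset.range n, max 0 (Real.log (x i) - v)) / n

/-! ### Hill's estimator and the distance in terms of the empirical tail and log-excess -/

section Empirical

variable {x : ℕ → ℝ} {n k : ℕ}

lemma antitone_empTail : Antitone (empTail x n) := fun a b hab => by
  refine div_le_div_of_nonneg_right (Finset.sum_le_sum fun i _ => ?_) (Nat.cast_nonneg n)
  exact indicator_le_indicator_of_subset (Ioi_subset_Ioi hab) (fun _ => zero_le_one) _

lemma antitone_empExcess : Antitone (empExcess x n) := fun a b hab => by
  refine div_le_div_of_nonneg_right (Finset.sum_le_sum fun i _ => ?_) (Nat.cast_nonneg n)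
  exact max_le_max le_rfl (by linarith)

lemma empTail_nonneg (z : ℝ) : 0 ≤ empTail x n z :=
  div_nonneg (Finset.sum_nonneg fun _ _ => indicator_nonneg (fun _ _ => zero_le_one) _)
    (Nat.cast_nonneg n)

lemma empExcess_nonneg (v : ℝ) : 0 ≤ empExcess x n v :=
  div_nonneg (Finset.sum_nonneg fun _ _ => le_max_left _ _) (Nat.cast_nonneg n)

lemma one_le_orderStat (hx : ∀ i, 1 ≤ x i) {j : ℕ} (h1 : 1 ≤ j) (h2 : j ≤ n) :
    1 ≤ orderStat x n j := by
  obtain ⟨i, hi⟩ := exists_orderStat_eq (x := x) h1 h2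
  rw [hi]; exact hx i

/-- Only the top `k` observations can exceed the threshold strictly; ties may make the count
smaller. Together with `le_empTail_of_lt_orderStat` this locates the threshold as an empirical
quantile. -/
lemma empTail_orderStat_le (hk : k < n) :
    empTail x n (orderStat x n (n - k)) ≤ k / n := by
  refine div_le_div_of_nonneg_right ?_ (Nat.cast_nonneg n)
  rw [← sum_Icc_orderStat_top hk
    ((Ioi (orderStat x n (n - k))).indicator (fun _ => (1 : ℝ)))
    fun z hz => indicator_of_notMem (by simpa using hz) _]
  calc _ ≤ ∑ i ∈ Finset.Icc 1 k, (1 : ℝ) :=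
        Finset.sum_le_sum fun i _ => indicator_le_self' (fun _ _ => zero_le_one) _
    _ = k := by simp

lemma le_empTail_of_lt_orderStat (hk : k < n) {z : ℝ} (hz : z < orderStat x n (n - k)) :
    (k : ℝ) / n ≤ empTail x n z := by
  refine div_le_div_of_nonneg_right ?_ (Nat.cast_nonneg n)
  rw [← sum_orderStat]
  calc (k : ℝ) = ∑ j ∈ Finset.Icc (n - k + 1) n, (1 : ℝ) := by
        rw [Finset.sum_const, Nat.card_Icc]
        simp only [nsmul_eq_mul, mul_one]
        congr 1; omega
    _ = ∑ j ∈ Finset.Icc (n - k + 1) n,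
          (Ioi z).indicator (fun _ => (1 : ℝ)) (orderStat x n j) := by
        refine Finset.sum_congr rfl fun j hj => ?_
        rw [Finset.mem_Icc] at hj
        rw [indicator_of_mem]
        exact hz.trans_le (orderStat_mono (by omega) (by omega) hj.2)
    _ ≤ _ := Finset.sum_le_sum_of_subset_of_nonneg (Finset.Icc_subset_Icc (by omega) le_rfl)
        fun j _ _ => indicator_nonneg (fun _ _ => zero_le_one) _

lemma hillH_eq (hx : ∀ i, 1 ≤ x i) (hk : k < n) :
    hillH x n k = (k / n : ℝ)⁻¹ * empExcess x n (Real.log (orderStat x n (n - k))) := by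
  have hT := one_le_orderStat (x := x) (n := n) hx (j := n - k) (by omega) (by omega)
  have hn : (n : ℝ) ≠ 0 := by
    have : 0 < n := by omega
    positivity
  -- The inner `max 1` makes the summand vanish at every real `z` below the threshold: `Real.log` is
  -- even, hence large at very negative `z`. On the sample it changes nothing.
  have h : ∑ i ∈ Finset.Icc 1 k,
      Real.log (orderStat x n (n - k + i) / orderStat x n (n - k)) =
      ∑ i ∈ Finset.range n, max 0 (Real.log (max 1 (x i)) -
        Real.log (orderStat x n (n - k))) := by
    rw [← sum_Icc_orderStat_top hk
      (fun z => max 0 (Real.log (max 1 z) - Real.log (orderStat x n (n - k))))]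
    · refine Finset.sum_congr rfl fun i hi => ?_
      rw [Finset.mem_Icc] at hi
      have h1 : orderStat x n (n - k) ≤ orderStat x n (n - k + i) :=
        orderStat_mono (by omega) (by omega) (by omega)
      have h2 := Real.log_le_log (by linarith) h1
      rw [Real.log_div (by linarith) (by linarith), max_eq_right (hT.trans h1),
        max_eq_right (by linarith)]
    · intro z hz
      refine max_eq_left (sub_nonpos.2 (Real.log_le_log (by positivity) (max_le hT hz)))
  have h' : ∀ i, max 1 (x i) = x i := fun i => max_eq_right (hx i)
  rw [hillH, h, empExcess]
  simp only [h']
  field_simp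

lemma ksDist_eq (hx : ∀ i, 1 ≤ x i) (hk : k < n) :
    ksDist x n k = ⨆ y : Ici (1 : ℝ), |(k / n : ℝ)⁻¹ * empTail x n (orderStat x n (n - k) * y)
      - (y : ℝ) ^ (-hillAlpha x n k)| := by
  have hT := one_le_orderStat (x := x) (n := n) hx (j := n - k) (by omega) (by omega)
  have hn : (n : ℝ) ≠ 0 := by
    have : 0 < n := by omega
    positivity
  refine iSup_congr fun y => ?_
  have hy : (1 : ℝ) ≤ y := y.2
  have hind : ∀ z : ℝ, (Ioi (y : ℝ)).indicator (fun _ => (1 : ℝ)) (z / orderStat x n (n - k)) =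
      (Ioi (orderStat x n (n - k) * y)).indicator (fun _ => (1 : ℝ)) z := fun z => by
    have : y < z / orderStat x n (n - k) ↔ orderStat x n (n - k) * y < z := by
      rw [lt_div_iff₀ (by linarith), mul_comm]
    simp only [indicator, mem_Ioi, this]
  simp only [hind]
  rw [sum_Icc_orderStat_top hk]
  · rw [empTail]
    congr 2
    field_simp
  · intro z hz
    refine indicator_of_notMem (fun h : _ < z => ?_) _
    nlinarith

end Empirical

/-! ### The tail of the law -/

section Tail

variable {ν : Measure ℝ}

lemma antitone_tailFn : Antitone (tailFn (cdf ν)) := fun _ _ h =>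
  sub_le_sub_left (monotone_cdf ν h) _

lemma tailFn_nonneg (z : ℝ) : 0 ≤ tailFn (cdf ν) z := sub_nonneg.2 (cdf_le_one ν z)

lemma tailFn_le_one (z : ℝ) : tailFn (cdf ν) z ≤ 1 := sub_le_self _ (cdf_nonneg ν z)

lemma tendsto_tailFn : Tendsto (tailFn (cdf ν)) atTop (𝓝 0) := by
  have := (tendsto_cdf_atTop ν).const_sub 1
  rwa [sub_self] at this

lemma ae_one_le (hsupp : ν (Iio 1) = 0) : ∀ᵐ z ∂ν, 1 ≤ z := by
  rw [ae_iff]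
  simpa [not_le, Iio] using hsupp

lemma one_sub_mem_Ioo {s : ℝ} (hs : s ∈ Ioo (0 : ℝ) 1) : 1 - s ∈ Ioo (0 : ℝ) 1 :=
  ⟨by linarith [hs.2], by linarith [hs.1]⟩

lemma aemeasurable_genInv (hinv : ContinuousOn (genInv (cdf ν)) (Ioo 0 1)) :
    AEMeasurable (fun s => genInv (cdf ν) (1 - s)) (volume.restrict (Ioo 0 1)) := by
  have : ContinuousOn (fun s => genInv (cdf ν) (1 - s)) (Ioo 0 1) :=
    hinv.comp (by fun_prop) fun s hs => one_sub_mem_Ioo hs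
  exact this.aemeasurable measurableSet_Ioo

/-- At `x = 1` the ratio tends to `1`, whereas it would be `0 / 0 = 0` wherever the tail vanishes.
So the tail is nonzero arbitrarily far out, and monotonicity does the rest. -/
lemma tailFn_pos {α : ℝ} (hRV : RegularlyVarying (-α) (tailFn (cdf ν))) (z : ℝ) :
    0 < tailFn (cdf ν) z := by
  have h := (hRV 1 one_pos).eventually (lt_mem_nhds (a := 0) (by simp))
  obtain ⟨t, ht, hzt⟩ := (h.and (eventually_ge_atTop z)).exists
  have h0 : tailFn (cdf ν) t ≠ 0 := fun h0 => by simp [h0] at ht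
  exact ((tailFn_nonneg t).lt_of_ne' h0).trans_le (antitone_tailFn hzt)

/-! ### Potter's bound -/

/-- Since `exp (-α) < exp (-α/2)`, multiplying a large argument by `e` shrinks the tail by at least
`exp (-α/2)`. Iterating `⌊v⌋` times gives the bound; rounding `v` down accounts for the `v - 1`. -/
lemma exists_tailFn_mul_exp_le {α : ℝ} (hα : 0 < α) (hRV : RegularlyVarying (-α) (tailFn (cdf ν))) :
    ∃ t₀ : ℝ, 1 ≤ t₀ ∧ ∀ t, t₀ ≤ t → ∀ v, 0 ≤ v →
      tailFn (cdf ν) (t * Real.exp v) ≤ Real.exp (-(α / 2) * (v - 1)) * tailFn (cdf ν) t := by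
  have h := (hRV (Real.exp 1) (Real.exp_pos 1)).eventually
    (gt_mem_nhds (b := Real.exp 1 ^ (-α)) (a := Real.exp (-(α / 2))) (by
      rw [← Real.exp_mul]
      exact Real.exp_lt_exp.2 (by linarith : 1 * -α < -(α / 2))))
  obtain ⟨t₀, ht₀⟩ := eventually_atTop.1 h
  refine ⟨max 1 t₀, le_max_left _ _, fun t ht v hv => ?_⟩
  have hstep : ∀ m : ℕ, tailFn (cdf ν) (t * Real.exp m) ≤
      Real.exp (-(α / 2) * m) * tailFn (cdf ν) t := by
    intro m
    induction m with
    | zero => simp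
    | succ m ih =>
      have ht1 : 1 ≤ t := (le_max_left _ _).trans ht
      have hge : t₀ ≤ t * Real.exp m := by
        have : 1 ≤ Real.exp m := Real.one_le_exp (Nat.cast_nonneg m)
        nlinarith [(le_max_right 1 t₀).trans ht]
      have h1 := ht₀ _ hge
      rw [div_lt_iff₀ (tailFn_pos hRV _)] at h1
      have e1 : t * Real.exp ((m + 1 : ℕ) : ℝ) = t * Real.exp m * Real.exp 1 := by
        rw [mul_assoc, ← Real.exp_add]; push_cast; rfl
      have e2 : Real.exp (-(α / 2) * ((m + 1 : ℕ) : ℝ)) =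
          Real.exp (-(α / 2)) * Real.exp (-(α / 2) * m) := by
        rw [← Real.exp_add]; push_cast; ring_nf
      rw [e1, e2, mul_assoc (Real.exp _)]
      exact h1.le.trans (mul_le_mul_of_nonneg_left ih (Real.exp_pos _).le)
  have ht0 : 0 ≤ t := zero_le_one.trans ((le_max_left _ _).trans ht)
  calc tailFn (cdf ν) (t * Real.exp v) ≤ tailFn (cdf ν) (t * Real.exp (⌊v⌋₊ : ℝ)) :=
        antitone_tailFn (mul_le_mul_of_nonneg_left
          (Real.exp_le_exp.2 (Nat.floor_le hv)) ht0)
    _ ≤ Real.exp (-(α / 2) * ⌊v⌋₊) * tailFn (cdf ν) t := hstep _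
    _ ≤ _ := by
      refine mul_le_mul_of_nonneg_right (Real.exp_le_exp.2 ?_) (tailFn_nonneg _)
      have := Nat.lt_floor_add_one v
      nlinarith

/-! ### The quantile transform -/

variable [IsProbabilityMeasure ν] {α : ℝ}

lemma tailFn_cdf (z : ℝ) : tailFn (cdf ν) z = ν.real (Ioi z) := by
  rw [tailFn, cdf_eq_real, ← compl_Iic, probReal_compl_eq_one_sub measurableSet_Iic]

lemma tailFn_of_lt_one (hsupp : ν (Iio 1) = 0) {z : ℝ} (hz : z < 1) :
    tailFn (cdf ν) z = 1 := by
  have : ν (Iic z) = 0 := measure_mono_null (Iic_subset_Iio.2 hz) hsupp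
  rw [tailFn, cdf_eq_real, measureReal_def, this]
  simp

/-- Right continuity of the distribution function lets the infimum satisfy its own inequality. The
restriction to positive points is harmless because the law lives on `[1, ∞)`. -/
lemma genInv_le_iff (hsupp : ν (Iio 1) = 0) {u : ℝ} (hu : u ∈ Ioo (0 : ℝ) 1) (z : ℝ) :
    genInv (cdf ν) u ≤ z ↔ u ≤ cdf ν z := by
  have hpos : ∀ w, u ≤ cdf ν w → 1 ≤ w := fun w hw => by
    by_contra! h
    have := tailFn_of_lt_one hsupp h
    rw [tailFn] at this
    linarith [hu.1]
  have hbdd : BddBelow {x : ℝ | 0 < x ∧ u ≤ cdf ν x} := ⟨0, fun w hw => hw.1.le⟩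
  constructor
  · intro h
    have hne : {x : ℝ | 0 < x ∧ u ≤ cdf ν x}.Nonempty := by
      obtain ⟨w, hw1, hw2⟩ := (((tendsto_cdf_atTop ν).eventually (lt_mem_nhds hu.2)).and
        (eventually_gt_atTop 0)).exists
      exact ⟨w, hw2, hw1.le⟩
    have hr : Tendsto (cdf ν) (𝓝[>] z) (𝓝 (cdf ν z)) :=
      ((cdf ν).right_continuous z).tendsto.mono_left (nhdsWithin_mono _ Ioi_subset_Ici_self)
    refine ge_of_tendsto hr ?_
    filter_upwards [self_mem_nhdsWithin] with w hw
    obtain ⟨y, hy, hyw⟩ := exists_lt_of_csInf_lt hne (h.trans_lt hw)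
    exact hy.2.trans (monotone_cdf ν hyw.le)
  · intro h
    exact csInf_le hbdd ⟨zero_lt_one.trans_le (hpos z h), h⟩

lemma one_le_genInv (hsupp : ν (Iio 1) = 0) {u : ℝ} (hu : u ∈ Ioo (0 : ℝ) 1) :
    1 ≤ genInv (cdf ν) u := by
  by_contra! h
  have h1 := (genInv_le_iff hsupp hu _).1 le_rfl
  have := tailFn_of_lt_one hsupp h
  rw [tailFn] at this
  linarith [hu.1]

lemma genInv_one_sub_le_iff (hsupp : ν (Iio 1) = 0) {s : ℝ} (hs : s ∈ Ioo (0 : ℝ) 1) (z : ℝ) :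
    genInv (cdf ν) (1 - s) ≤ z ↔ tailFn (cdf ν) z ≤ s := by
  rw [genInv_le_iff hsupp (one_sub_mem_Ioo hs), tailFn]
  constructor <;> intro h <;> linarith

/-- A continuous generalized inverse makes the tail strictly decreasing where it is below one. -/
lemma eq_of_tailFn_eq (hRV : RegularlyVarying (-α) (tailFn (cdf ν))) (hsupp : ν (Iio 1) = 0)
    (hinv : ContinuousOn (genInv (cdf ν)) (Ioo 0 1)) {x t : ℝ} (hx : 0 < cdf ν x)
    (h : tailFn (cdf ν) t = tailFn (cdf ν) x) : t = x := by
  -- If `F` were flat on `[a, b]`, the inverse would be at most `a` at level `F a` and at least `b`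
  -- at every higher level, a jump. Positivity of `F a` keeps the level inside `(0, 1)`.
  have key : ∀ a b : ℝ, 0 < cdf ν a → cdf ν a = cdf ν b → ¬ a < b := by
    intro a b ha hab hlt
    have hu : cdf ν a ∈ Ioo (0 : ℝ) 1 := ⟨ha, by
      have := tailFn_pos hRV a; rw [tailFn] at this; linarith⟩
    have hle : genInv (cdf ν) (cdf ν a) ≤ a := (genInv_le_iff hsupp hu a).2 le_rfl
    have hc := (hinv.continuousAt (Ioo_mem_nhds hu.1 hu.2)).tendsto.mono_left
      (nhdsWithin_le_nhds (s := Ioi (cdf ν a)))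
    have hb : b ≤ genInv (cdf ν) (cdf ν a) := by
      refine ge_of_tendsto hc ?_
      filter_upwards [Ioo_mem_nhdsGT hu.2] with s hs
      by_contra! hlt'
      have := (genInv_le_iff hsupp ⟨hu.1.trans hs.1, hs.2⟩ b).1 hlt'.le
      linarith [hs.1]
    linarith
  have h' : cdf ν t = cdf ν x := by simpa [tailFn] using h
  rcases lt_trichotomy t x with hlt | heq | hlt
  · exact absurd hlt (key _ _ (h' ▸ hx) h')
  · exact heq
  · exact absurd hlt (key _ _ hx h'.symm)

/-- The quantile transform of the uniform law has law `ν`. -/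
lemma map_genInv (hRV : RegularlyVarying (-α) (tailFn (cdf ν))) (hsupp : ν (Iio 1) = 0)
    (hinv : ContinuousOn (genInv (cdf ν)) (Ioo 0 1)) :
    Measure.map (fun s => genInv (cdf ν) (1 - s)) (volume.restrict (Ioo 0 1)) = ν := by
  refine Measure.ext_of_Iic _ _ fun z => ?_
  rw [Measure.map_apply_of_aemeasurable (aemeasurable_genInv hinv) measurableSet_Iic,
    Measure.restrict_apply' measurableSet_Ioo]
  have : (fun s => genInv (cdf ν) (1 - s)) ⁻¹' Iic z ∩ Ioo 0 1 = Ico (tailFn (cdf ν) z) 1 := by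
    ext s
    simp only [mem_inter_iff, mem_preimage, mem_Iic, mem_Ico]
    constructor
    · rintro ⟨h1, h2⟩
      exact ⟨(genInv_one_sub_le_iff hsupp h2 z).1 h1, h2.2⟩
    · rintro ⟨h1, h2⟩
      have hs : s ∈ Ioo (0 : ℝ) 1 := ⟨(tailFn_pos hRV z).trans_le h1, h2⟩
      exact ⟨(genInv_one_sub_le_iff hsupp hs z).2 h1, hs⟩
  rw [this, Real.volume_Ico, tailFn, sub_sub_cancel, ofReal_cdf]

/-! ### Integrability of the logarithm -/

lemma integrableOn_log_genInv (hα : 0 < α) (hRV : RegularlyVarying (-α) (tailFn (cdf ν)))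
    (hsupp : ν (Iio 1) = 0) (hinv : ContinuousOn (genInv (cdf ν)) (Ioo 0 1)) :
    IntegrableOn (fun s => Real.log (genInv (cdf ν) (1 - s))) (Ioo 0 1) := by
  obtain ⟨t₀, ht₀, hP⟩ := exists_tailFn_mul_exp_le hα hRV
  have hlog : IntegrableOn Real.log (Ioo 0 1) := by
    have := (intervalIntegral.intervalIntegrable_log' (a := 0) (b := 1)).1
    exact this.mono_set Ioo_subset_Ioc_self
  have hb : IntegrableOn (fun s => (Real.log t₀ + 1) - 2 / α * Real.log s) (Ioo 0 1) := by
    refine Integrable.sub (integrableOn_const (by simp)) (hlog.const_mul _)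
  refine Integrable.mono' hb
    (Real.measurable_log.comp_aemeasurable (aemeasurable_genInv hinv)).aestronglyMeasurable ?_
  filter_upwards [ae_restrict_mem measurableSet_Ioo] with s hs
  have h1 := one_le_genInv hsupp (one_sub_mem_Ioo hs)
  rw [Real.norm_of_nonneg (Real.log_nonneg h1)]
  have hls : Real.log s ≤ 0 := Real.log_nonpos hs.1.le hs.2.le
  -- The exponent `v = 1 - (2/α) log s` is the one for which Potter's factor `exp (-(α/2)(v - 1))`
  -- equals `s`. The resulting majorant is affine in `log s`, hence integrable.
  have h2 : genInv (cdf ν) (1 - s) ≤ t₀ * Real.exp (1 - 2 / α * Real.log s) := by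
    rw [genInv_one_sub_le_iff hsupp hs]
    refine (hP t₀ le_rfl _ ?_).trans ?_
    · have : 0 ≤ 2 / α * -Real.log s := mul_nonneg (by positivity) (by linarith)
      linarith
    · have : -(α / 2) * (1 - 2 / α * Real.log s - 1) = Real.log s := by field_simp; ring
      rw [this, Real.exp_log hs.1]
      exact mul_le_of_le_one_right hs.1.le (tailFn_le_one _)
  have h3 := Real.log_le_log (by linarith) h2
  rw [Real.log_mul (by positivity) (by positivity), Real.log_exp] at h3
  linarith

lemma integrable_log (hα : 0 < α) (hRV : RegularlyVarying (-α) (tailFn (cdf ν)))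
    (hsupp : ν (Iio 1) = 0) (hinv : ContinuousOn (genInv (cdf ν)) (Ioo 0 1)) :
    Integrable Real.log ν := by
  rw [← map_genInv hRV hsupp hinv, integrable_map_measure
    Real.measurable_log.aestronglyMeasurable (aemeasurable_genInv hinv)]
  exact integrableOn_log_genInv hα hRV hsupp hinv

end Tail

/-! ### The mean excess of the logarithm -/

/-- The expected excess of `log Z` over `v`, where `Z` has law `ν`. -/
noncomputable def logExcess (ν : Measure ℝ) (v : ℝ) : ℝ := ∫ z, max 0 (Real.log z - v) ∂ν

section LogExcess

variable {ν : Measure ℝ} [IsProbabilityMeasure ν] {α : ℝ}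

lemma integrable_logExcess (hlog : Integrable Real.log ν) (v : ℝ) :
    Integrable (fun z => max 0 (Real.log z - v)) ν :=
  (integrable_zero _ _ _).sup (hlog.sub (integrable_const v))

lemma continuous_logExcess (hlog : Integrable Real.log ν) : Continuous (logExcess ν) := by
  refine continuous_iff_continuousAt.2 fun v₀ => ?_
  refine continuousAt_of_dominated (bound := fun z => |Real.log z| + (|v₀| + 1))
    (Eventually.of_forall fun v => (integrable_logExcess hlog v).aestronglyMeasurable) ?_
    (hlog.abs.add (integrable_const _)) (ae_of_all _ fun z => by fun_prop)
  filter_upwards [Metric.ball_mem_nhds v₀ one_pos] with v hv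
  refine ae_of_all _ fun z => ?_
  rw [Metric.mem_ball, Real.dist_eq] at hv
  rw [Real.norm_of_nonneg (le_max_left _ _)]
  have h1 := abs_lt.1 hv
  have h2 := neg_abs_le v₀
  have h3 := le_abs_self (Real.log z)
  exact max_le (by positivity) (by linarith)

/-- Under the quantile transform, levels `s` below the tail at `x` correspond to values at least
`x`, and the positive part vanishes at the remaining levels. -/
lemma integral_log_genInv_div (hRV : RegularlyVarying (-α) (tailFn (cdf ν)))
    (hsupp : ν (Iio 1) = 0) (hinv : ContinuousOn (genInv (cdf ν)) (Ioo 0 1)) {x : ℝ}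
    (hx : 1 ≤ x) :
    ∫ s in (0 : ℝ)..tailFn (cdf ν) x, Real.log (genInv (cdf ν) (1 - s) / x) =
      logExcess ν (Real.log x) := by
  have hm : Measurable fun z => max 0 (Real.log z - Real.log x) := by fun_prop
  have h1 : logExcess ν (Real.log x) =
      ∫ s in Ioo 0 1, max 0 (Real.log (genInv (cdf ν) (1 - s)) - Real.log x) := by
    conv_lhs => rw [logExcess, ← map_genInv hRV hsupp hinv]
    rw [integral_map (aemeasurable_genInv hinv) hm.aestronglyMeasurable]
  rw [h1, intervalIntegral.integral_of_le (tailFn_nonneg x), integral_Ioc_eq_integral_Ioo]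
  have hsub : Ioo 0 (tailFn (cdf ν) x) ⊆ Ioo 0 1 := Ioo_subset_Ioo_right (tailFn_le_one x)
  rw [setIntegral_eq_of_subset_of_forall_sdiff_eq_zero measurableSet_Ioo hsub
    (f := fun s => max 0 (Real.log (genInv (cdf ν) (1 - s)) - Real.log x))]
  · refine setIntegral_congr_fun measurableSet_Ioo fun s hs => ?_
    have h1 := one_le_genInv hsupp (one_sub_mem_Ioo (hsub hs))
    have h2 : x ≤ genInv (cdf ν) (1 - s) := by
      by_contra! h
      have := (genInv_one_sub_le_iff hsupp (hsub hs) x).1 h.le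
      linarith [hs.2]
    have h3 := Real.log_le_log (by linarith) h2
    rw [Real.log_div (by linarith) (by linarith), max_eq_right (by linarith)]
  · intro s hs
    have h1 := one_le_genInv hsupp (one_sub_mem_Ioo hs.1)
    have h2 : tailFn (cdf ν) x ≤ s := by
      by_contra! h
      exact hs.2 ⟨hs.1.1, h⟩
    have h3 := (genInv_one_sub_le_iff hsupp hs.1 x).2 h2
    exact max_eq_left (sub_nonpos.2 (Real.log_le_log (by linarith) h3))

lemma intervalIntegrable_log_genInv (hα : 0 < α)
    (hRV : RegularlyVarying (-α) (tailFn (cdf ν)))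
    (hsupp : ν (Iio 1) = 0) (hinv : ContinuousOn (genInv (cdf ν)) (Ioo 0 1)) (x : ℝ) :
    IntervalIntegrable (fun s => Real.log (genInv (cdf ν) (1 - s))) volume
      0 (tailFn (cdf ν) x) := by
  rw [intervalIntegrable_iff_integrableOn_Ioo_of_le (tailFn_nonneg x)]
  exact (integrableOn_log_genInv hα hRV hsupp hinv).mono_set
    (Ioo_subset_Ioo_right (tailFn_le_one x))

lemma integral_log_genInv_div_eq_sub (hα : 0 < α)
    (hRV : RegularlyVarying (-α) (tailFn (cdf ν)))
    (hsupp : ν (Iio 1) = 0) (hinv : ContinuousOn (genInv (cdf ν)) (Ioo 0 1)) {x : ℝ}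
    (hx : 1 ≤ x) :
    ∫ s in (0 : ℝ)..tailFn (cdf ν) x, Real.log (genInv (cdf ν) (1 - s) / x) =
      (∫ s in (0 : ℝ)..tailFn (cdf ν) x, Real.log (genInv (cdf ν) (1 - s))) -
        Real.log x * tailFn (cdf ν) x := by
  have h : ∫ s in (0 : ℝ)..tailFn (cdf ν) x, Real.log (genInv (cdf ν) (1 - s) / x) =
      ∫ s in (0 : ℝ)..tailFn (cdf ν) x,
        (Real.log (genInv (cdf ν) (1 - s)) - Real.log x) := by
    refine intervalIntegral.integral_congr_Ioo_of_le (tailFn_nonneg x) fun s hs => ?_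
    have h1 := one_le_genInv hsupp (one_sub_mem_Ioo ⟨hs.1, hs.2.trans_le (tailFn_le_one x)⟩)
    exact Real.log_div (by linarith) (by linarith)
  rw [h, intervalIntegral.integral_sub (intervalIntegrable_log_genInv hα hRV hsupp hinv x)
    intervalIntegrable_const, intervalIntegral.integral_const]
  simp [mul_comm]

lemma logExcess_pos (hα : 0 < α) (hRV : RegularlyVarying (-α) (tailFn (cdf ν)))
    (hsupp : ν (Iio 1) = 0) (hinv : ContinuousOn (genInv (cdf ν)) (Ioo 0 1)) {x : ℝ}
    (hx : 1 ≤ x) : 0 < logExcess ν (Real.log x) := by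
  have hlog := integrable_log hα hRV hsupp hinv
  rw [logExcess, integral_pos_iff_support_of_nonneg (f := fun z => max 0 (Real.log z - Real.log x))
    (fun z => le_max_left _ _) (integrable_logExcess hlog _)]
  have h : 0 < ν (Ioi x) := by
    have := tailFn_pos hRV x
    rw [tailFn_cdf, measureReal_def] at this
    exact (ENNReal.toReal_pos_iff.1 this).1
  refine h.trans_le (measure_mono fun z hz => ?_)
  have := Real.log_lt_log (by linarith) (mem_Ioi.1 hz)
  exact (lt_max_of_lt_right (by linarith)).ne'

/-- The expected log-excess over `x`, conditionally on exceeding `x`. -/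
noncomputable def meanLogExcess (ν : Measure ℝ) (x : ℝ) : ℝ :=
  logExcess ν (Real.log x) / tailFn (cdf ν) x

lemma meanLogExcess_pos (hα : 0 < α) (hRV : RegularlyVarying (-α) (tailFn (cdf ν)))
    (hsupp : ν (Iio 1) = 0) (hinv : ContinuousOn (genInv (cdf ν)) (Ioo 0 1)) {x : ℝ}
    (hx : 1 ≤ x) : 0 < meanLogExcess ν x :=
  div_pos (logExcess_pos hα hRV hsupp hinv hx) (tailFn_pos hRV x)

/-- Layer-cake formula: for `v > 0` the log-excess over `x` is larger than `v` exactly when `Z > x *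
exp v`. -/
lemma logExcess_eq_integral_tailFn (hlog : Integrable Real.log ν) (hsupp : ν (Iio 1) = 0)
    {x : ℝ} (hx : 1 ≤ x) :
    logExcess ν (Real.log x) = ∫ v in Ioi (0 : ℝ), tailFn (cdf ν) (x * Real.exp v) := by
  rw [logExcess, (integrable_logExcess hlog _).integral_eq_integral_meas_lt
    (ae_of_all _ fun z => le_max_left _ _)]
  refine setIntegral_congr_fun measurableSet_Ioi fun v hv => ?_
  rw [tailFn_cdf]
  refine measureReal_congr ?_
  filter_upwards [ae_one_le hsupp] with z hz
  have hv' : 0 < v := hv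
  refine propext ?_
  change v < max 0 (Real.log z - Real.log x) ↔ x * Real.exp v < z
  rw [lt_max_iff, or_iff_right (not_lt.2 hv'.le), lt_sub_iff_add_lt', Real.lt_log_iff_exp_lt
    (by linarith), Real.exp_add, Real.exp_log (by linarith)]

/-- Karamata's theorem for the mean excess of the logarithm. -/
lemma tendsto_meanLogExcess (hα : 0 < α) (hRV : RegularlyVarying (-α) (tailFn (cdf ν)))
    (hsupp : ν (Iio 1) = 0) (hinv : ContinuousOn (genInv (cdf ν)) (Ioo 0 1)) :
    Tendsto (meanLogExcess ν) atTop (𝓝 α⁻¹) := by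
  obtain ⟨t₀, ht₀, hP⟩ := exists_tailFn_mul_exp_le hα hRV
  have hlog := integrable_log hα hRV hsupp hinv
  have hint : ∫ v in Ioi (0 : ℝ), Real.exp v ^ (-α) = α⁻¹ := by
    have := integral_exp_mul_Ioi (a := -α) (neg_lt_zero.2 hα) 0
    simp only [← Real.exp_mul, mul_comm _ (-α)]
    rw [this]
    simp
  have hmain : Tendsto (fun x => ∫ v in Ioi (0 : ℝ),
      tailFn (cdf ν) (x * Real.exp v) / tailFn (cdf ν) x) atTop
      (𝓝 (∫ v in Ioi (0 : ℝ), Real.exp v ^ (-α))) := by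
    -- Potter's bound supplies the majorant; regular variation at `exp v` gives the pointwise limit.
    refine tendsto_integral_filter_of_dominated_convergence
      (fun v => Real.exp (-(α / 2) * (v - 1))) ?_ ?_ ?_ ?_
    · filter_upwards with x
      exact ((antitone_tailFn.measurable.comp (by fun_prop)).div_const _).aestronglyMeasurable
    · filter_upwards [eventually_ge_atTop t₀] with x hx
      filter_upwards [ae_restrict_mem measurableSet_Ioi] with v hv
      rw [Real.norm_of_nonneg (div_nonneg (tailFn_nonneg _) (tailFn_nonneg _)),
        div_le_iff₀ (tailFn_pos hRV x)]
      exact hP x hx v (le_of_lt hv)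
    · have h : (fun v => Real.exp (-(α / 2) * (v - 1))) =
          fun v => Real.exp (α / 2) * Real.exp (-(α / 2) * v) := by
        funext v; rw [← Real.exp_add]; ring_nf
      rw [h]
      exact (integrableOn_exp_mul_Ioi (by linarith) 0).const_mul _
    · exact ae_of_all _ fun v => hRV _ (Real.exp_pos v)
  rw [hint] at hmain
  refine hmain.congr' ?_
  filter_upwards [eventually_ge_atTop 1] with x hx
  rw [meanLogExcess, logExcess_eq_integral_tailFn hlog hsupp hx, integral_div]

/-! ### The limiting distance -/

/-- Splitting off `log x` turns the numerator into `α` times the denominator minus the tail at `x`.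
-/
lemma calU_eq (hα : 0 < α) (hRV : RegularlyVarying (-α) (tailFn (cdf ν)))
    (hsupp : ν (Iio 1) = 0) (hinv : ContinuousOn (genInv (cdf ν)) (Ioo 0 1)) {x : ℝ}
    (hx : 1 ≤ x) : calU α (cdf ν) x = α - (meanLogExcess ν x)⁻¹ := by
  have h1 := integral_log_genInv_div_eq_sub hα hRV hsupp hinv hx
  rw [integral_log_genInv_div hRV hsupp hinv hx] at h1
  have h2 := (logExcess_pos hα hRV hsupp hinv hx).ne'
  rw [calU, integral_log_genInv_div hRV hsupp hinv hx, meanLogExcess, inv_div,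
    ← sub_eq_zero]
  field_simp
  rw [h1]
  ring

/-- The factor `y ^ (-α)` cancels the `y ^ α` hidden both in `y ^ U(x)` and in `L(xy)/L(x)`, leaving
a conditional tail against a fitted Pareto tail. -/
lemma limitGap_eq (hα : 0 < α) (hRV : RegularlyVarying (-α) (tailFn (cdf ν)))
    (hsupp : ν (Iio 1) = 0) (hinv : ContinuousOn (genInv (cdf ν)) (Ioo 0 1)) {x y : ℝ}
    (hx : 1 ≤ x) (hy : 1 ≤ y) : limitGap α (cdf ν) x y =
      |tailFn (cdf ν) (x * y) / tailFn (cdf ν) x - y ^ (-(meanLogExcess ν x)⁻¹)| := by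
  have hx0 : 0 < x := by linarith
  have hy0 : 0 < y := by linarith
  have hG := (tailFn_pos hRV x).ne'
  have hya := Real.rpow_pos_of_pos hy0 α
  have hxa := Real.rpow_pos_of_pos hx0 α
  rw [limitGap, calU_eq hα hRV hsupp hinv hx, slowPart, slowPart,
    Real.mul_rpow hx0.le hy0.le, sub_eq_add_neg α, Real.rpow_add hy0,
    abs_sub_comm (_ / _), Real.rpow_neg hy0.le α]
  nth_rewrite 1 [← abs_of_pos (inv_pos.2 hya)]
  rw [← abs_mul]
  congr 1
  field_simp

lemma abs_tail_sub_rpow_le_one (hα : 0 < α) (hRV : RegularlyVarying (-α) (tailFn (cdf ν)))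
    (hsupp : ν (Iio 1) = 0) (hinv : ContinuousOn (genInv (cdf ν)) (Ioo 0 1)) {x y : ℝ}
    (hx : 1 ≤ x) (hy : 1 ≤ y) :
      |tailFn (cdf ν) (x * y) / tailFn (cdf ν) x - y ^ (-(meanLogExcess ν x)⁻¹)| ≤ 1 := by
  have h1 : y ^ (-(meanLogExcess ν x)⁻¹) ≤ 1 := Real.rpow_le_one_of_one_le_of_nonpos hy
    (neg_nonpos.2 (inv_pos.2 (meanLogExcess_pos hα hRV hsupp hinv hx)).le)
  have h2 : 0 ≤ y ^ (-(meanLogExcess ν x)⁻¹) := Real.rpow_nonneg (by linarith) _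
  have h3 : tailFn (cdf ν) (x * y) / tailFn (cdf ν) x ≤ 1 :=
    div_le_one_of_le₀ (antitone_tailFn (by nlinarith)) (tailFn_nonneg x)
  have h4 : 0 ≤ tailFn (cdf ν) (x * y) / tailFn (cdf ν) x :=
    div_nonneg (tailFn_nonneg _) (tailFn_nonneg _)
  rw [abs_le]
  constructor <;> linarith

lemma bddAbove_limitGap (hα : 0 < α) (hRV : RegularlyVarying (-α) (tailFn (cdf ν)))
    (hsupp : ν (Iio 1) = 0) (hinv : ContinuousOn (genInv (cdf ν)) (Ioo 0 1)) {x : ℝ}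
    (hx : 1 ≤ x) : BddAbove (range fun y : Ici (1 : ℝ) => limitGap α (cdf ν) x y) := by
  refine ⟨1, ?_⟩
  rintro _ ⟨y, rfl⟩
  simp only
  rw [limitGap_eq hα hRV hsupp hinv hx y.2]
  exact abs_tail_sub_rpow_le_one hα hRV hsupp hinv hx y.2

lemma iSup_limitGap_pos (hα : 0 < α) (hRV : RegularlyVarying (-α) (tailFn (cdf ν)))
    (hsupp : ν (Iio 1) = 0) (hinv : ContinuousOn (genInv (cdf ν)) (Ioo 0 1))
    (hF : ¬ EventuallyPareto α (cdf ν)) {x : ℝ} (hx : 1 ≤ x) :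
    0 < ⨆ y : Ici (1 : ℝ), limitGap α (cdf ν) x y := by
  by_contra! hle
  refine hF ?_
  set a := (meanLogExcess ν x)⁻¹ with ha
  have hx0 : 0 < x := by linarith
  have heq : ∀ y, 1 ≤ y → tailFn (cdf ν) (x * y) = tailFn (cdf ν) x * y ^ (-a) := by
    intro y hy
    have h := (le_ciSup (bddAbove_limitGap hα hRV hsupp hinv hx) ⟨y, hy⟩).trans hle
    simp only at h
    rw [limitGap_eq hα hRV hsupp hinv hx hy] at h
    have h' := abs_nonpos_iff.1 h
    rw [sub_eq_zero, div_eq_iff (tailFn_pos hRV x).ne'] at h'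
    rw [h', mul_comm]
  have heq' : ∀ z, x ≤ z → tailFn (cdf ν) z = tailFn (cdf ν) x * x ^ a * z ^ (-a) := by
    intro z hz
    have h := heq (z / x) ((one_le_div hx0).2 hz)
    rw [mul_div_cancel₀ z hx0.ne'] at h
    rw [h, Real.div_rpow (by linarith) hx0.le, Real.rpow_neg hx0.le a, div_inv_eq_mul]
    ring
  have hc : 0 < tailFn (cdf ν) x * x ^ a := mul_pos (tailFn_pos hRV x) (Real.rpow_pos_of_pos hx0 a)
  -- The tail is now a pure power with exponent `-a`; comparing its ratio at `2` with regular
  -- variation forces `a = α`.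
  have hlim : Tendsto (fun t => tailFn (cdf ν) (t * 2) / tailFn (cdf ν) t) atTop
      (𝓝 ((2 : ℝ) ^ (-a))) := by
    refine tendsto_const_nhds.congr' ?_
    filter_upwards [eventually_ge_atTop x] with t ht
    have ht0 : 0 < t := by linarith
    rw [heq' t ht, heq' (t * 2) (by linarith), Real.mul_rpow ht0.le (by norm_num), ← mul_assoc,
      mul_div_cancel_left₀ _ (mul_pos hc (Real.rpow_pos_of_pos ht0 (-a))).ne']
  have h2 := tendsto_nhds_unique hlim (hRV 2 two_pos)
  have h3 : -a = -α := by
    have h4 := congrArg Real.log h2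
    rw [Real.log_rpow two_pos, Real.log_rpow two_pos] at h4
    exact mul_right_cancel₀ (Real.log_pos one_lt_two).ne' h4
  rw [h3] at heq'
  exact ⟨x, _, hc, heq'⟩

/-- Both the conditional tail and the fitted Pareto tail tend to `y ^ (-α)` uniformly: the first by
regular variation and Pólya's theorem, the second because Karamata's theorem makes the fitted
exponent tend to `α`. -/
lemma tendsto_iSup_limitGap (hα : 0 < α) (hRV : RegularlyVarying (-α) (tailFn (cdf ν)))
    (hsupp : ν (Iio 1) = 0) (hinv : ContinuousOn (genInv (cdf ν)) (Ioo 0 1)) :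
    Tendsto (fun x => ⨆ y : Ici (1 : ℝ), limitGap α (cdf ν) x y) atTop (𝓝 0) := by
  have hrpow : ContinuousOn (fun y : ℝ => y ^ (-α)) (Ici 1) :=
    continuousOn_id.rpow_const fun y hy => Or.inl (zero_lt_one.trans_le hy).ne'
  have h1 : TendstoUniformlyOn
      (fun x y => tailFn (cdf ν) (x * y) / tailFn (cdf ν) x) (fun y => y ^ (-α))
      atTop (Ici 1) := by
    refine tendstoUniformlyOn_of_antitoneOn ?_ hrpow (tendsto_rpow_neg_atTop hα)
      fun y hy => hRV y (by linarith)
    filter_upwards [eventually_ge_atTop 1] with x hx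
    refine ⟨fun a _ b _ hab => div_le_div_of_nonneg_right
      (antitone_tailFn (mul_le_mul_of_nonneg_left hab (by linarith))) (tailFn_nonneg x),
      fun y _ => div_nonneg (tailFn_nonneg _) (tailFn_nonneg _)⟩
  have h2 : TendstoUniformlyOn (fun x (y : ℝ) => y ^ (-(meanLogExcess ν x)⁻¹))
      (fun y => y ^ (-α)) atTop (Ici 1) := by
    refine tendstoUniformlyOn_rpow_neg ?_ hα ?_
    · filter_upwards [eventually_ge_atTop 1] with x hx
      exact (inv_pos.2 (meanLogExcess_pos hα hRV hsupp hinv hx)).le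
    · simpa using (tendsto_meanLogExcess hα hRV hsupp hinv).inv₀ (inv_ne_zero hα.ne')
  have h3 := tendsto_iSup_abs_sub h1 h2 ⟨0, by rintro _ ⟨y, rfl⟩; simp⟩
  simp only [sub_self, abs_zero, Real.iSup_const_zero] at h3
  refine h3.congr' ?_
  filter_upwards [eventually_ge_atTop 1] with x hx
  exact iSup_congr fun y => (limitGap_eq hα hRV hsupp hinv hx y.2).symm

end LogExcess

/-! ### Convergence of the distance along a filter -/

section Convergence

variable {ν : Measure ℝ} {α : ℝ} {ι : Type*} {n k : ι → ℕ}
  {x : ι → ℕ → ℝ}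

lemma exists_tendsto_orderStat (hcont : Continuous (tailFn (cdf ν))) (U : Ultrafilter ι)
    (hx : ∀ᶠ i in (U : Filter ι), ∀ j, 1 ≤ x i j) (hk : ∀ᶠ i in (U : Filter ι), k i < n i)
    (htail : ∀ z, Tendsto (fun i => empTail (x i) (n i) z) U (𝓝 (tailFn (cdf ν) z)))
    {u : ℝ} (hu : 0 < u) (hku : Tendsto (fun i => (k i : ℝ) / n i) U (𝓝 u)) :
    ∃ t, 1 ≤ t ∧ tailFn (cdf ν) t = u ∧
      Tendsto (fun i => orderStat (x i) (n i) (n i - k i)) U (𝓝 t) := by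
  -- A threshold above `B` would make the empirical tail at `B` at least `k/n`, although its limit
  -- is below `u`. This confines the threshold to a compact interval.
  obtain ⟨B, hB⟩ := ((tendsto_tailFn (ν := ν)).eventually (gt_mem_nhds hu)).exists
  have hT : ∀ᶠ i in (U : Filter ι), orderStat (x i) (n i) (n i - k i) ∈ Icc 1 B := by
    filter_upwards [hx, hk, (htail B).eventually_lt hku hB] with i h1 h2 h3
    refine ⟨one_le_orderStat h1 (by omega) (by omega), ?_⟩
    by_contra! h
    exact absurd (le_empTail_of_lt_orderStat h2 h) (not_le.2 h3)
  obtain ⟨t, ht, hTt⟩ := U.exists_tendsto_nhds_of_mem_Icc hT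
  refine ⟨t, ht.1, le_antisymm ?_ ?_, hTt⟩
  · have hle : ∀ z ∈ Ioi t, tailFn (cdf ν) z ≤ u := fun z hz => by
      refine le_of_tendsto_of_tendsto (htail z) hku ?_
      filter_upwards [hk, hTt.eventually (gt_mem_nhds hz)] with i h1 h2
      exact (antitone_empTail h2.le).trans (empTail_orderStat_le h1)
    exact le_of_tendsto (hcont.continuousAt.tendsto.mono_left nhdsWithin_le_nhds)
      (eventually_nhdsWithin_of_forall hle)
  · have hge : ∀ z ∈ Iio t, u ≤ tailFn (cdf ν) z := fun z hz => by
      refine le_of_tendsto_of_tendsto hku (htail z) ?_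
      filter_upwards [hk, hTt.eventually (lt_mem_nhds hz)] with i h1 h2
      exact le_empTail_of_lt_orderStat h1 h2
    exact ge_of_tendsto (hcont.continuousAt.tendsto.mono_left nhdsWithin_le_nhds)
      (eventually_nhdsWithin_of_forall hge)

variable [IsProbabilityMeasure ν]

/-- Only pointwise limits at deterministic arguments are assumed; antitonicity transfers them to the
random threshold and to the supremum over `y`. The filter is arbitrary, so the lemma serves both
fixed levels and the random optimizer. -/
lemma tendsto_ksDist (hα : 0 < α) (hRV : RegularlyVarying (-α) (tailFn (cdf ν)))
    (hsupp : ν (Iio 1) = 0) (hcont : Continuous (tailFn (cdf ν)))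
    (hinv : ContinuousOn (genInv (cdf ν)) (Ioo 0 1)) {l : Filter ι}
    (hx : ∀ᶠ i in l, ∀ j, 1 ≤ x i j) (hk : ∀ᶠ i in l, k i < n i)
    (htail : ∀ z, Tendsto (fun i => empTail (x i) (n i) z) l (𝓝 (tailFn (cdf ν) z)))
    (hexcess : ∀ v, Tendsto (fun i => empExcess (x i) (n i) v) l (𝓝 (logExcess ν v)))
    {t : ℝ} (ht : 1 ≤ t)
    (hkt : Tendsto (fun i => (k i : ℝ) / n i) l (𝓝 (tailFn (cdf ν) t)))
    (hT : Tendsto (fun i => orderStat (x i) (n i) (n i - k i)) l (𝓝 t)) :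
    Tendsto (fun i => ksDist (x i) (n i) (k i)) l
      (𝓝 (⨆ y : Ici (1 : ℝ), limitGap α (cdf ν) t y)) := by
  have hG := tailFn_pos hRV t
  have hH := meanLogExcess_pos hα hRV hsupp hinv ht
  have ht0 : 0 < t := by linarith
  have hkinv := hkt.inv₀ hG.ne'
  have h1 : TendstoUniformlyOn (fun i (y : ℝ) => (k i / n i : ℝ)⁻¹ *
      empTail (x i) (n i) (orderStat (x i) (n i) (n i - k i) * y))
      (fun y => tailFn (cdf ν) (t * y) / tailFn (cdf ν) t) l (Ici 1) := by
    refine tendstoUniformlyOn_of_antitoneOn ?_ ?_ ?_ ?_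
    · filter_upwards [hx, hk] with i h1 h2
      have h3 := one_le_orderStat h1 (j := n i - k i) (n := n i) (by omega) (by omega)
      refine ⟨fun a _ b _ hab => mul_le_mul_of_nonneg_left
        (antitone_empTail (mul_le_mul_of_nonneg_left hab (by linarith))) (by positivity),
        fun y _ => mul_nonneg (by positivity) (empTail_nonneg _)⟩
    · exact ((hcont.comp (by fun_prop)).div_const _).continuousOn
    · have := (tendsto_tailFn (ν := ν)).comp (tendsto_id.const_mul_atTop ht0)
      simpa using this.div_const (tailFn (cdf ν) t)
    · intro y _
      have := hkinv.mul (tendsto_apply_of_antitone (Eventually.of_forall fun i => antitone_empTail)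
        htail hcont.continuousAt (hT.mul_const y))
      rwa [mul_comm, ← div_eq_mul_inv] at this
  have h2 : TendstoUniformlyOn (fun i (y : ℝ) => y ^ (-hillAlpha (x i) (n i) (k i)))
      (fun y => y ^ (-(meanLogExcess ν t)⁻¹)) l (Ici 1) := by
    have heq : ∀ᶠ i in l, hillAlpha (x i) (n i) (k i) = ((k i / n i : ℝ)⁻¹ *
        empExcess (x i) (n i) (Real.log (orderStat (x i) (n i) (n i - k i))))⁻¹ := by
      filter_upwards [hx, hk] with i h1 h2
      rw [hillAlpha, hillH_eq h1 h2]
    refine tendstoUniformlyOn_rpow_neg ?_ (inv_pos.2 hH) (Tendsto.congr' (heq.mono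
      fun _ h => h.symm) (Tendsto.inv₀ ?_ hH.ne'))
    · filter_upwards [heq] with i hi
      rw [hi]
      exact inv_nonneg.2 (mul_nonneg (by positivity) (empExcess_nonneg _))
    · rw [meanLogExcess, div_eq_inv_mul]
      exact hkinv.mul (tendsto_apply_of_antitone
        (Eventually.of_forall fun i => antitone_empExcess) hexcess
        (continuous_logExcess (integrable_log hα hRV hsupp hinv)).continuousAt
        ((Real.continuousAt_log ht0.ne').tendsto.comp hT))
  have h3 := tendsto_iSup_abs_sub h1 h2 ⟨1, by
    rintro _ ⟨y, rfl⟩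
    exact abs_tail_sub_rpow_le_one hα hRV hsupp hinv ht y.2⟩
  have h4 : (⨆ y : Ici (1 : ℝ), |tailFn (cdf ν) (t * y) / tailFn (cdf ν) t -
      (y : ℝ) ^ (-(meanLogExcess ν t)⁻¹)|) = ⨆ y : Ici (1 : ℝ), limitGap α (cdf ν) t y :=
    iSup_congr fun y => (limitGap_eq hα hRV hsupp hinv ht y.2).symm
  rw [h4] at h3
  refine h3.congr' ?_
  filter_upwards [hx, hk] with i h1 h2
  exact (ksDist_eq h1 h2).symm

end Convergence

/-! ### Laws of large numbers -/

section Sample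

variable {Ω : Type*} [MeasurableSpace Ω] {P : Measure Ω}
  {ν : Measure ℝ} {X : ℕ → Ω → ℝ} {α : ℝ}

lemma eventually_whp_one_le (hlaw : ∀ i, HasLaw (X i) ν P) (hsupp : ν (Iio 1) = 0) :
    ∀ᶠ p in whp P, ∀ j, 1 ≤ X j p.1 := by
  refine eventually_whp_of_ae (p := fun ω => ∀ j, 1 ≤ X j ω) (ae_all_iff.2 fun j => ?_)
  have h := ae_one_le hsupp
  rw [← (hlaw j).map_eq] at h
  exact ae_of_ae_map (hlaw j).aemeasurable h

variable [IsProbabilityMeasure P]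

lemma tendsto_average_whp (hlaw : ∀ i, HasLaw (X i) ν P) (hindep : iIndepFun X P)
    {φ : ℝ → ℝ} (hφm : Measurable φ) (hφ : Integrable φ ν) :
    Tendsto (fun p : Ω × ℕ => (∑ i ∈ Finset.range p.2, φ (X i p.1)) / p.2) (whp P)
      (𝓝 (∫ z, φ z ∂ν)) := by
  have hXm := fun i => (hlaw i).aemeasurable
  have hY : ∀ i, AEMeasurable (fun ω => φ (X i ω)) P := fun i => hφm.comp_aemeasurable (hXm i)
  have hE : ∫ ω, φ (X 0 ω) ∂P = ∫ z, φ z ∂ν := by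
    rw [← (hlaw 0).map_eq, integral_map (hXm 0) hφm.aestronglyMeasurable]
  have hslln := strong_law_ae_real (μ := P) (fun i ω => φ (X i ω))
    (by
      have h : Integrable φ (P.map (X 0)) := by rwa [(hlaw 0).map_eq]
      exact (integrable_map_measure hφm.aestronglyMeasurable (hXm 0)).1 h)
    (fun i j hij => (hindep.indepFun hij).comp hφm hφm)
    (fun i => IdentDistrib.comp ⟨hXm i, hXm 0, by rw [(hlaw i).map_eq, (hlaw 0).map_eq]⟩ hφm)
  rw [hE] at hslln
  refine (tendstoInMeasure_const_iff_whp
    (f := fun n ω => (∑ i ∈ Finset.range n, φ (X i ω)) / n)).1 ?_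
  refine tendstoInMeasure_of_tendsto_ae (fun n => ?_) hslln
  exact ((Finset.aemeasurable_fun_sum _ fun i _ => hY i).div_const _).aestronglyMeasurable

variable [IsProbabilityMeasure ν]

lemma tendsto_empTail_whp (hlaw : ∀ i, HasLaw (X i) ν P) (hindep : iIndepFun X P) (z : ℝ) :
    Tendsto (fun p : Ω × ℕ => empTail (fun i => X i p.1) p.2 z) (whp P)
      (𝓝 (tailFn (cdf ν) z)) := by
  have h := tendsto_average_whp hlaw hindep
    (φ := (Ioi z).indicator fun _ => (1 : ℝ)) (measurable_const.indicator measurableSet_Ioi)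
    ((integrable_const _).indicator measurableSet_Ioi)
  rw [integral_indicator_const _ measurableSet_Ioi, smul_eq_mul, mul_one, ← tailFn_cdf] at h
  exact h

lemma tendsto_empExcess_whp (hlaw : ∀ i, HasLaw (X i) ν P) (hindep : iIndepFun X P)
    (hlog : Integrable Real.log ν) (v : ℝ) :
    Tendsto (fun p : Ω × ℕ => empExcess (fun i => X i p.1) p.2 v) (whp P)
      (𝓝 (logExcess ν v)) :=
  tendsto_average_whp hlaw hindep (φ := fun z => max 0 (Real.log z - v)) (by fun_prop)
    (integrable_logExcess hlog v)

/-! ### The distance at a fixed level and at the optimizer -/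

lemma tendsto_ksDist_whp (hlaw : ∀ i, HasLaw (X i) ν P) (hindep : iIndepFun X P)
    (hsupp : ν (Iio 1) = 0) (hα : 0 < α) (hRV : RegularlyVarying (-α) (tailFn (cdf ν)))
    (hcont : Continuous (tailFn (cdf ν))) (hinv : ContinuousOn (genInv (cdf ν)) (Ioo 0 1))
    {x : ℝ} (hx : 0 < cdf ν x) :
    Tendsto (fun p : Ω × ℕ => ksDist (fun i => X i p.1) p.2 ⌊tailFn (cdf ν) x * p.2⌋₊) (whp P)
      (𝓝 (⨆ y : Ici (1 : ℝ), limitGap α (cdf ν) x y)) := by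
  have hlog := integrable_log hα hRV hsupp hinv
  have hG := tailFn_pos hRV x
  have hk : Tendsto (fun p : Ω × ℕ => ((⌊tailFn (cdf ν) x * p.2⌋₊ : ℕ) : ℝ) / p.2) (whp P)
      (𝓝 (tailFn (cdf ν) x)) :=
    (tendsto_nat_floor_mul_div_atTop hG.le).comp
      (tendsto_natCast_atTop_atTop.comp tendsto_snd_whp)
  have hkn : ∀ᶠ p : Ω × ℕ in whp P, ⌊tailFn (cdf ν) x * p.2⌋₊ < p.2 := by
    filter_upwards [tendsto_snd_whp.eventually (eventually_gt_atTop 0)] with p hp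
    have hp' : (0 : ℝ) < p.2 := Nat.cast_pos.2 hp
    rw [Nat.floor_lt (by positivity)]
    have : tailFn (cdf ν) x < 1 := by rw [tailFn]; linarith
    nlinarith
  rw [tendsto_iff_ultrafilter]
  intro U hU
  have hx1 := (eventually_whp_one_le hlaw hsupp).filter_mono hU
  obtain ⟨t, ht, htx, hT⟩ := exists_tendsto_orderStat hcont U hx1 (hkn.filter_mono hU)
    (fun z => (tendsto_empTail_whp hlaw hindep z).mono_left hU) hG (hk.mono_left hU)
  -- Every limit point of the threshold has the same tail value as `x`; continuity of the inverse
  -- identifies it with `x`.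
  obtain rfl := eq_of_tailFn_eq hRV hsupp hinv hx htx
  exact tendsto_ksDist hα hRV hsupp hcont hinv hx1 (hkn.filter_mono hU)
    (fun z => (tendsto_empTail_whp hlaw hindep z).mono_left hU)
    (fun v => (tendsto_empExcess_whp hlaw hindep hlog v).mono_left hU) ht (hk.mono_left hU) hT

end Sample

/-- For `n ≥ 2` the candidate set is finite and nonempty, so `sInf` is an attained minimum and not
the default `0`. -/
lemma plfitOpt_spec (x : ℕ → ℝ) {n : ℕ} (hn : 2 ≤ n) :
    (1 ≤ plfitOpt x n ∧ plfitOpt x n < n) ∧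
      ∀ j, 1 ≤ j → j < n → ksDist x n (plfitOpt x n) ≤ ksDist x n j := by
  obtain ⟨k, hk, hmin⟩ := Finset.exists_min_image (Finset.Ico 1 n) (ksDist x n)
    ⟨1, Finset.mem_Ico.2 ⟨le_rfl, hn⟩⟩
  exact Nat.sInf_mem (s := {k : ℕ | (1 ≤ k ∧ k < n) ∧
    ∀ j : ℕ, 1 ≤ j → j < n → ksDist x n k ≤ ksDist x n j})
    ⟨k, Finset.mem_Ico.1 hk, fun j h1 h2 => hmin j (Finset.mem_Ico.2 ⟨h1, h2⟩)⟩

lemma tendsto_plfitOpt_whp {Ω : Type*} [MeasurableSpace Ω] {P : Measure Ω}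
    [IsProbabilityMeasure P] {ν : Measure ℝ} [IsProbabilityMeasure ν] {X : ℕ → Ω → ℝ} {α : ℝ}
    (hlaw : ∀ i, HasLaw (X i) ν P) (hindep : iIndepFun X P)
    (hsupp : ν (Iio 1) = 0) (hα : 0 < α) (hRV : RegularlyVarying (-α) (tailFn (cdf ν)))
    (hcont : Continuous (tailFn (cdf ν))) (hinv : ContinuousOn (genInv (cdf ν)) (Ioo 0 1))
    (hF : ¬ EventuallyPareto α (cdf ν)) :
    Tendsto (fun p : Ω × ℕ => (plfitOpt (fun i => X i p.1) p.2 : ℝ) / p.2) (whp P) (𝓝 0) := by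
  have hlog := integrable_log hα hRV hsupp hinv
  have hspec : ∀ᶠ p : Ω × ℕ in whp P, 2 ≤ p.2 :=
    tendsto_snd_whp.eventually (eventually_ge_atTop 2)
  rw [tendsto_iff_ultrafilter]
  intro U hU
  have hU2 := hspec.filter_mono hU
  obtain ⟨u, hu, hUu⟩ := U.exists_tendsto_nhds_of_mem_Icc
    (u := fun p : Ω × ℕ => (plfitOpt (fun i => X i p.1) p.2 : ℝ) / p.2) (a := 0) (b := 1) (by
      filter_upwards [hU2] with p hp
      refine ⟨by positivity, div_le_one_of_le₀ ?_ (Nat.cast_nonneg _)⟩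
      exact_mod_cast (plfitOpt_spec (fun i => X i p.1) hp).1.2.le)
  rcases hu.1.eq_or_lt with rfl | hu0
  · exact hUu
  exfalso
  have hx1 := (eventually_whp_one_le hlaw hsupp).filter_mono hU
  have htail := fun z => (tendsto_empTail_whp hlaw hindep z).mono_left hU
  have hkn : ∀ᶠ p : Ω × ℕ in (U : Filter _), plfitOpt (fun i => X i p.1) p.2 < p.2 :=
    hU2.mono fun p hp => (plfitOpt_spec _ hp).1.2
  obtain ⟨t, ht, htu, hT⟩ := exists_tendsto_orderStat hcont U hx1 hkn htail hu0 hUu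
  subst htu
  have hlim := tendsto_ksDist hα hRV hsupp hcont hinv hx1 hkn htail
    (fun v => (tendsto_empExcess_whp hlaw hindep hlog v).mono_left hU) ht hUu hT
  -- Minimality is tested against the competitor `k = ⌊tailFn z * n⌋`, which is admissible for large
  -- `n` and whose distance tends to `M(z)`.
  have hle : ∀ᶠ z in atTop, (⨆ y : Ici (1 : ℝ), limitGap α (cdf ν) t y) ≤
      ⨆ y : Ici (1 : ℝ), limitGap α (cdf ν) z y := by
    filter_upwards [(tendsto_cdf_atTop ν).eventually (lt_mem_nhds zero_lt_one)] with z hz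
    refine le_of_tendsto_of_tendsto hlim
      ((tendsto_ksDist_whp hlaw hindep hsupp hα hRV hcont hinv hz).mono_left hU) ?_
    have hG := tailFn_pos hRV z
    have hG1 : tailFn (cdf ν) z < 1 := by rw [tailFn]; linarith
    have hN : ∀ᶠ m : ℕ in atTop, 1 ≤ tailFn (cdf ν) z * m :=
      (tendsto_natCast_atTop_atTop.const_mul_atTop hG).eventually (eventually_ge_atTop 1)
    filter_upwards [hU2, (tendsto_snd_whp.mono_left hU).eventually hN] with p hp hp'
    refine (plfitOpt_spec _ hp).2 _ (Nat.le_floor (by simpa using hp')) ?_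
    rw [Nat.floor_lt (by positivity)]
    have : (0 : ℝ) < p.2 := by positivity
    nlinarith
  have hnonpos := ge_of_tendsto (tendsto_iSup_limitGap hα hRV hsupp hinv) hle
  exact absurd (iSup_limitGap_pos hα hRV hsupp hinv hF ht) (not_lt.2 hnonpos)

theorem mainTheorem5 {Ω : Type*} [MeasurableSpace Ω] (P : Measure Ω) [IsProbabilityMeasure P]
    (ν : Measure ℝ) [IsProbabilityMeasure ν] (X : ℕ → Ω → ℝ)
    (hlaw : ∀ i, HasLaw (X i) ν P) (hindep : iIndepFun X P)
    (hsupp : ν (Iio 1) = 0)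
    (α : ℝ) (hα : 0 < α)
    (hRV : RegularlyVarying (-α) (tailFn (cdf ν)))
    (hcont : Continuous (tailFn (cdf ν)))
    (hinv : ContinuousOn (genInv (cdf ν)) (Ioo 0 1)) :
    -- the exponent and the supremum in the limit are well defined
    (∀ x : ℝ, 1 ≤ x →
      IntervalIntegrable (fun s => Real.log (genInv (cdf ν) (1 - s))) volume
        0 (tailFn (cdf ν) x) ∧
      0 < ∫ s in (0 : ℝ)..tailFn (cdf ν) x, Real.log (genInv (cdf ν) (1 - s) / x) ∧
      BddAbove (range fun y : Ici (1 : ℝ) => limitGap α (cdf ν) x y)) ∧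
    -- convergence of the distance at a fixed level
    (∀ x : ℝ, 0 < cdf ν x →
      TendstoInMeasure P
        (fun (n : ℕ) (ω : Ω) => ksDist (fun i => X i ω) n ⌊tailFn (cdf ν) x * n⌋₊)
        atTop (fun _ => ⨆ y : Ici (1 : ℝ), limitGap α (cdf ν) x y)) ∧
    -- positivity of the limit
    (¬ EventuallyPareto α (cdf ν) →
      ∀ x : ℝ, 1 ≤ x → 0 < ⨆ y : Ici (1 : ℝ), limitGap α (cdf ν) x y) ∧
    -- sublinearity of the optimizer
    (¬ EventuallyPareto α (cdf ν) →
      TendstoInMeasure P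
        (fun (n : ℕ) (ω : Ω) => (plfitOpt (fun i => X i ω) n : ℝ) / n)
        atTop (fun _ => (0 : ℝ))) := by
  refine ⟨fun x hx => ⟨intervalIntegrable_log_genInv hα hRV hsupp hinv x, ?_,
      bddAbove_limitGap hα hRV hsupp hinv hx⟩, fun x hx => ?_,
    fun hF x hx => iSup_limitGap_pos hα hRV hsupp hinv hF hx, fun hF => ?_⟩
  · rw [integral_log_genInv_div hRV hsupp hinv hx]
    exact logExcess_pos hα hRV hsupp hinv hx
  · exact tendstoInMeasure_const_iff_whp.2
      (tendsto_ksDist_whp hlaw hindep hsupp hα hRV hcont hinv hx)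
  · exact tendstoInMeasure_const_iff_whp.2
      (tendsto_plfitOpt_whp hlaw hindep hsupp hα hRV hcont hinv hF)
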